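/- Let $R$ be a commutative ring with $1$. An element $v$ of a free $R$-module $F$ is unimodular if $f(v)=1$ for some $R$-linear map $f:F\to R$. The ring $R$ is a Hermite ring if every $v\in R^2$ can be written $v=ru$ with $r\in R$ and $u\in R^2$ unimodular; it is a pre-Schreier ring if whenever $x$ divides $yz$ in $R$ there are $u,v\in R$ with $x=uv$, $u\mid y$ and $v\mid z$; it is an elementary divisor ring (EDR) if for all $m,n\ge 1$ and every $m\times n$ matrix $A$ over $R$ there are $P\in GL_m(R)$ and $Q\in GL_n(R)$ such that $PAQ$ has zero off-diagonal entries and each of its diagonal entries divides the next. A unimodular matrix $A\in \mathbb M_2(R)$ is weakly determinant liftable if there is $B\in \mathbb M_2(R)$ with $\det(B)=0$ and all entries of $A-B$ in $R\det(A)$. Assume $R$ is a reduced Hermite ring which is also a pre-Schreier ring. Then the following are equivalent: 1. $R$ is an EDR; 2. each unimodular matrix in $\mathbb M_2(R)$ is weakly determinant liftable; 3. for each unimodular triple $(a,b,c)\in R^3$ there exists $(x,y,z,w)\in R^4$ such that $(1-ax)(1-cw)=y(b+acz)$. -/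

import Mathlib

/-- An element `v` of a (free) `R`-module `F` is unimodular if some `R`-linear form on `F` takes
the value `1` at `v`. -/
def IsUnimodular (R : Type*) [CommRing R] {F : Type*} [AddCommGroup F] [Module R F] (v : F) :
    Prop :=
  ∃ f : F →ₗ[R] R, f v = 1

/-- `R` is a Hermite ring in the sense of Kaplansky: `R² = R · Um(R²)`. -/
def IsHermiteRing (R : Type*) [CommRing R] : Prop :=
  ∀ v : Fin 2 → R, ∃ (r : R) (u : Fin 2 → R), IsUnimodular R u ∧ v = r • u

/-- `A` is equivalent to a matrix whose off-diagonal entries are `0` and each of whose diagonal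
entries divides the next one. -/
def AdmitsDiagonalReduction {R : Type*} [CommRing R] {m n : ℕ} (A : Matrix (Fin m) (Fin n) R) :
    Prop :=
  ∃ (P : GL (Fin m) R) (Q : GL (Fin n) R) (D : Matrix (Fin m) (Fin n) R),
    (P : Matrix (Fin m) (Fin m) R) * A * (Q : Matrix (Fin n) (Fin n) R) = D ∧
    (∀ (i : Fin m) (j : Fin n), (i : ℕ) ≠ (j : ℕ) → D i j = 0) ∧
    (∀ (k : ℕ) (hm : k + 1 < m) (hn : k + 1 < n),
      D ⟨k, Nat.lt_of_succ_lt hm⟩ ⟨k, Nat.lt_of_succ_lt hn⟩ ∣ D ⟨k + 1, hm⟩ ⟨k + 1, hn⟩)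

/-- `R` is an elementary divisor ring: every matrix over `R`, of any size, admits diagonal
reduction. -/
def IsElementaryDivisorRing (R : Type*) [CommRing R] : Prop :=
  ∀ m n : ℕ, 1 ≤ m → 1 ≤ n → ∀ A : Matrix (Fin m) (Fin n) R, AdmitsDiagonalReduction A

/-- `A` is weakly determinant liftable: some matrix of zero determinant is congruent to `A` modulo
the ideal generated by `det A`. (The notion is used for unimodular `A` only.) -/
def IsWeaklyDeterminantLiftable {R : Type*} [CommRing R] (A : Matrix (Fin 2) (Fin 2) R) : Prop :=
  ∃ B : Matrix (Fin 2) (Fin 2) R,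
    (∀ i j, A i j - B i j ∈ Ideal.span {A.det}) ∧ B.det = 0

/-! Over a Hermite ring everything reduces to one property of unimodular `2 × 2` matrices `A`: some
bilinear value `x ⬝ᵥ A *ᵥ y` equals `1`. An induction on rows extends this to all sizes. Completing
`x` and `y` to invertible matrices then puts a `1` in the corner, and clearing its row and column
leaves a smaller matrix to diagonalize.

An EDR gives (2) by replacing the second diagonal entry, a multiple of `det A`, by `0`. It gives (3)
by reading off the unit corner of a diagonal form of `!![a, b; 0, c]`. Conversely (3) is exactly the
vanishing of the determinant of an explicit lift of that triangular matrix, so it implies (2).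

The core is (2) implies (1). The pre-Schreier property factors the off-diagonal entry of a
triangularized lift of determinant zero, and reducedness separates its diagonal entries, so `A` is a
column times a row modulo `Δ = det A`. In adapted bases all entries of `A` but one are then
multiples of `Δ`, and the first row becomes unimodular, so `1` is a value. -/

open Matrix

/-! ### Unimodular vectors and extraction of common factors. -/

section Unimodular

variable {R : Type*} [CommRing R]

theorem isUnimodular_pi_iff {ι : Type*} [Fintype ι] {u : ι → R} :
    IsUnimodular R u ↔ ∃ w : ι → R, u ⬝ᵥ w = 1 := by
  classical
  constructor
  · rintro ⟨f, hf⟩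
    refine ⟨fun i => f (Pi.single i 1), Eq.trans ?_ hf⟩
    have hu : u = ∑ i, u i • (Pi.single i 1 : ι → R) := pi_eq_sum_univ' u
    conv_rhs => rw [hu]
    simp [dotProduct]
  · rintro ⟨w, hw⟩
    refine ⟨∑ i, w i • LinearMap.proj i, ?_⟩
    rw [← hw]
    simp [dotProduct, mul_comm]

theorem isUnimodular_matrix_iff {m n : Type*} [Fintype m] [Fintype n] {A : Matrix m n R} :
    IsUnimodular R A ↔ ∃ W : Matrix m n R, ∑ i, ∑ j, A i j * W i j = 1 := by
  classical
  constructor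
  · rintro ⟨f, hf⟩
    refine ⟨fun i j => f (Matrix.single i j 1), Eq.trans ?_ hf⟩
    conv_rhs => rw [Matrix.matrix_eq_sum_single A]
    simp only [map_sum]
    refine Finset.sum_congr rfl fun i _ => Finset.sum_congr rfl fun j _ => ?_
    have h := f.map_smul (A i j) (Matrix.single i j 1)
    rwa [Matrix.smul_single, smul_eq_mul, smul_eq_mul, mul_one, eq_comm] at h
  · rintro ⟨W, hW⟩
    refine ⟨∑ i, ∑ j, W i j • Matrix.entryLinearMap R R i j, ?_⟩
    rw [← hW]
    simp [LinearMap.sum_apply, mul_comm]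

theorem isUnit_of_dvd_unimodular {m n : Type*} [Fintype m] [Fintype n] {A : Matrix m n R}
    (hA : IsUnimodular R A) {d : R} (hd : ∀ i j, d ∣ A i j) : IsUnit d := by
  obtain ⟨W, hW⟩ := isUnimodular_matrix_iff.1 hA
  refine isUnit_of_dvd_one ?_
  rw [← hW]
  exact Finset.dvd_sum fun i _ => Finset.dvd_sum fun j _ => (hd i j).mul_right _

theorem IsHermiteRing.exists_pair (hR : IsHermiteRing R) (a b : R) :
    ∃ r a' b' x y : R, a = r * a' ∧ b = r * b' ∧ a' * x + b' * y = 1 := by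
  obtain ⟨r, u, hu, h⟩ := hR ![a, b]
  obtain ⟨w, hw⟩ := isUnimodular_pi_iff.1 hu
  exact ⟨r, u 0, u 1, w 0, w 1, by simpa using congrFun h 0, by simpa using congrFun h 1,
    by simpa [dotProduct, Fin.sum_univ_two] using hw⟩

theorem IsHermiteRing.exists_eq_smul_fin (hR : IsHermiteRing R) (n : ℕ) (v : Fin (n + 1) → R) :
    ∃ (r : R) (u w : Fin (n + 1) → R), v = r • u ∧ u ⬝ᵥ w = 1 := by
  induction n with
  | zero =>
    refine ⟨v 0, 1, 1, ?_, by simp⟩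
    ext i
    fin_cases i
    simp
  | succ n ih =>
    obtain ⟨s, u, w, hv, huw⟩ := ih (Fin.tail v)
    obtain ⟨r, a, b, x, y, ha, hb, hxy⟩ := hR.exists_pair (v 0) s
    refine ⟨r, Fin.cons a (b • u), Fin.cons x (y • w), ?_, ?_⟩
    · ext i
      refine Fin.cases (by simpa using ha) (fun i => ?_) i
      have := congrFun hv i
      simp only [Fin.tail, Pi.smul_apply, smul_eq_mul] at this
      simp [this, hb, mul_assoc]
    · have : b • u ⬝ᵥ y • w = b * y := by simp [huw, mul_comm]
      rw [← hxy, ← this]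
      simp [dotProduct, Fin.sum_univ_succ]

theorem IsHermiteRing.exists_eq_smul (hR : IsHermiteRing R) {ι : Type*} [Fintype ι] [Nonempty ι]
    (v : ι → R) : ∃ (r : R) (u w : ι → R), v = r • u ∧ u ⬝ᵥ w = 1 := by
  obtain ⟨n, hn⟩ := Nat.exists_eq_succ_of_ne_zero (Fintype.card_ne_zero (α := ι))
  have e : ι ≃ Fin (n + 1) := Fintype.equivFinOfCardEq hn
  obtain ⟨r, u, w, hv, huw⟩ := hR.exists_eq_smul_fin n (v ∘ e.symm)
  refine ⟨r, u ∘ e, w ∘ e, ?_, ?_⟩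
  · ext i
    simpa using congrFun hv (e i)
  · rw [← huw]
    exact e.sum_comp fun i => u i * w i

theorem IsHermiteRing.exists_matrix_eq_smul (hR : IsHermiteRing R) {m n : Type*} [Fintype m]
    [Fintype n] [Nonempty m] [Nonempty n] (A : Matrix m n R) :
    ∃ (r : R) (A' : Matrix m n R), A = r • A' ∧ IsUnimodular R A' := by
  obtain ⟨r, u, w, hv, huw⟩ := hR.exists_eq_smul fun p : m × n => A p.1 p.2
  refine ⟨r, fun i j => u (i, j), ?_, isUnimodular_matrix_iff.2 ⟨fun i j => w (i, j), ?_⟩⟩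
  · ext i j
    exact congrFun hv (i, j)
  · rw [← huw, dotProduct, Fintype.sum_prod_type]

end Unimodular

/-! ### Bilinear values: from `2 × 2` matrices to all sizes. -/

section BilinearValues

variable {R : Type*} [CommRing R]

theorem exists_dotProduct_mulVec_eq_one_of_dvd {m n : Type*} [Fintype m] [Fintype n]
    {A : Matrix m n R} (hA : IsUnimodular R A)
    (h : ∃ x y, ∀ i j, x ⬝ᵥ A *ᵥ y ∣ A i j) : ∃ x y, x ⬝ᵥ A *ᵥ y = 1 := by
  obtain ⟨x, y, h⟩ := h
  obtain ⟨d, hd⟩ := isUnit_iff_exists_inv.1 (isUnit_of_dvd_unimodular hA h)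
  exact ⟨x, d • y, by rw [mulVec_smul, dotProduct_smul, smul_eq_mul, mul_comm, hd]⟩

/-- If every unimodular `2 × 2` matrix over a Hermite ring represents `1` as a bilinear form, then
every matrix represents a generator of the ideal spanned by its entries. -/
theorem IsHermiteRing.exists_dotProduct_mulVec_dvd (hR : IsHermiteRing R)
    (h2 : ∀ M : Matrix (Fin 2) (Fin 2) R, IsUnimodular R M → ∃ x y, x ⬝ᵥ M *ᵥ y = 1)
    (m n : ℕ) (A : Matrix (Fin (m + 1)) (Fin (n + 1)) R) :
    ∃ x y, ∀ i j, x ⬝ᵥ A *ᵥ y ∣ A i j := by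
  induction m with
  | zero =>
    obtain ⟨r, u, w, hv, huw⟩ := hR.exists_eq_smul_fin n (A 0)
    refine ⟨1, w, fun i j => ?_⟩
    have h : (1 : Fin (0 + 1) → R) ⬝ᵥ A *ᵥ w = A 0 ⬝ᵥ w := by
      simp [dotProduct, mulVec]
    rw [h, hv, smul_dotProduct, huw, Fin.fin_one_eq_zero i, hv]
    simp
  | succ m ih =>
    obtain ⟨r, A', hA', hu⟩ := hR.exists_matrix_eq_smul (A.submatrix Fin.succ id)
    obtain ⟨x, y, hxy⟩ := exists_dotProduct_mulVec_eq_one_of_dvd hu (ih A')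
    set φ := x ᵥ* A' with hφ
    rw [dotProduct_mulVec, ← hφ] at hxy
    -- The first row splits as a multiple of `φ` plus `t • g`. Projecting `v` to the kernel of `φ`
    -- along `y` gives `z`, on which the first row still takes the value `t`.
    obtain ⟨t, g, v, hg, hgv⟩ := hR.exists_eq_smul_fin n (A 0 - (A 0 ⬝ᵥ y) • φ)
    set z := v - (φ ⬝ᵥ v) • y with hz
    have hφz : φ ⬝ᵥ z = 0 := by simp [hz, dotProduct_sub, hxy]
    have hAz : A 0 ⬝ᵥ z = t := by
      have h := congrArg (· ⬝ᵥ v) hg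
      simp only [sub_dotProduct, smul_dotProduct, hgv, smul_eq_mul] at h
      rw [hz, dotProduct_sub, dotProduct_smul, smul_eq_mul]
      linear_combination h
    -- This is the form `A` restricted to the left vectors `(1, 0)`, `(0, x)` and the right vectors
    -- `y`, `z`. Its content `d` divides `A 0 ⬝ᵥ y`, `t` and `r`, hence every entry of `A`.
    obtain ⟨d, M, hM, hMu⟩ := hR.exists_matrix_eq_smul !![A 0 ⬝ᵥ y, t; r, 0]
    obtain ⟨ξ, η, hξ⟩ := h2 M hMu
    have h00 : A 0 ⬝ᵥ y = d * M 0 0 := by simpa using congrFun₂ hM 0 0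
    have h01 : t = d * M 0 1 := by simpa using congrFun₂ hM 0 1
    have h10 : r = d * M 1 0 := by simpa using congrFun₂ hM 1 0
    have h11 : 0 = d * M 1 1 := by simpa using congrFun₂ hM 1 1
    have hsucc : ∀ i : Fin (m + 1), A i.succ = r • A' i := fun i => funext fun j =>
      congrFun₂ hA' i j
    have hval : (Fin.cons (ξ 0) (ξ 1 • x) : Fin (m + 2) → R) ⬝ᵥ A *ᵥ (η 0 • y + η 1 • z) = d := by
      have e1 : (Fin.cons (ξ 0) (ξ 1 • x) : Fin (m + 2) → R) ⬝ᵥ A *ᵥ (η 0 • y + η 1 • z) =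
          ξ 0 * (A 0 ⬝ᵥ (η 0 • y + η 1 • z)) +
            ξ 1 * (r * (x ⬝ᵥ A' *ᵥ (η 0 • y + η 1 • z))) := by
        simp only [dotProduct, mulVec, Fin.sum_univ_succ (n := m + 1), Fin.cons_zero,
          Fin.cons_succ, hsucc, Pi.smul_apply, smul_eq_mul, Finset.mul_sum]
        congr 1
        refine Finset.sum_congr rfl fun i _ => Finset.sum_congr rfl fun j _ => ?_
        ring
      rw [e1, dotProduct_mulVec, ← hφ]
      simp only [dotProduct_add, dotProduct_smul, hxy, hφz, hAz, smul_eq_mul]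
      simp only [dotProduct, mulVec, Fin.sum_univ_two] at hξ
      linear_combination d * hξ + ξ 0 * η 0 * h00 + ξ 0 * η 1 * h01 + ξ 1 * η 0 * h10 +
        ξ 1 * η 1 * h11
    refine ⟨_, _, fun i j => hval.symm ▸ (?_ : d ∣ A i j)⟩
    refine Fin.cases ?_ (fun i => ?_) i
    · have h := congrFun hg j
      simp only [Pi.sub_apply, Pi.smul_apply, smul_eq_mul] at h
      exact ⟨M 0 0 * φ j + M 0 1 * g j, by
        linear_combination h + φ j * h00 + g j * h01⟩
    · rw [hsucc, h10]
      simp [mul_assoc]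

end BilinearValues

/-! ### Block matrices and completion of unimodular vectors. -/

section Blocks

variable {R : Type*} [CommRing R]

/-- The block diagonal matrix with blocks `1` and `A`. -/
def oneBlock {m n : ℕ} (A : Matrix (Fin m) (Fin n) R) : Matrix (Fin (m + 1)) (Fin (n + 1)) R :=
  Matrix.of (Fin.cons (Fin.cons 1 0) fun i => Fin.cons 0 (A i))

@[simp] theorem oneBlock_zero_zero {m n : ℕ} (A : Matrix (Fin m) (Fin n) R) :
    oneBlock A 0 0 = 1 := rfl

@[simp] theorem oneBlock_zero_succ {m n : ℕ} (A : Matrix (Fin m) (Fin n) R) (j : Fin n) :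
    oneBlock A 0 j.succ = 0 := rfl

@[simp] theorem oneBlock_succ_zero {m n : ℕ} (A : Matrix (Fin m) (Fin n) R) (i : Fin m) :
    oneBlock A i.succ 0 = 0 := rfl

@[simp] theorem oneBlock_succ_succ {m n : ℕ} (A : Matrix (Fin m) (Fin n) R) (i : Fin m)
    (j : Fin n) : oneBlock A i.succ j.succ = A i j := rfl

theorem oneBlock_mul {l m n : ℕ} (A : Matrix (Fin l) (Fin m) R) (B : Matrix (Fin m) (Fin n) R) :
    oneBlock A * oneBlock B = oneBlock (A * B) := by
  ext i j
  refine Fin.cases ?_ (fun i => ?_) i <;> refine Fin.cases ?_ (fun j => ?_) j <;>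
    simp [Matrix.mul_apply, Fin.sum_univ_succ]

theorem oneBlock_one {n : ℕ} : oneBlock (1 : Matrix (Fin n) (Fin n) R) = 1 := by
  ext i j
  refine Fin.cases ?_ (fun i => ?_) i <;> refine Fin.cases ?_ (fun j => ?_) j <;>
    simp [Matrix.one_apply, Fin.succ_ne_zero, (Fin.succ_ne_zero _).symm]

/-- `oneBlock` on invertible matrices. -/
def oneBlockGL {n : ℕ} (P : GL (Fin n) R) : GL (Fin (n + 1)) R where
  val := oneBlock P
  inv := oneBlock ↑P⁻¹
  val_inv := by rw [oneBlock_mul, Units.mul_inv, oneBlock_one]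
  inv_val := by rw [oneBlock_mul, Units.inv_mul, oneBlock_one]

/-- The matrix acting by `!![a, b; c, d]` on the first two coordinates and trivially on the
others. -/
def twoBlock (n : ℕ) (a b c d : R) : Matrix (Fin (n + 2)) (Fin (n + 2)) R :=
  Matrix.of (Fin.cons (Fin.cons a (Fin.cons b 0)) (Fin.cons (Fin.cons c (Fin.cons d 0))
    fun i => Fin.cons 0 (Fin.cons 0 ((1 : Matrix (Fin n) (Fin n) R) i))))

theorem twoBlock_mul_adjugate (n : ℕ) {a b c d : R} (h : a * d - b * c = 1) :
    twoBlock n a b c d * twoBlock n d (-b) (-c) a = 1 := by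
  ext i j
  refine Fin.cases ?_ (Fin.cases ?_ fun i => ?_) i <;>
    refine Fin.cases ?_ (Fin.cases ?_ fun j => ?_) j <;>
    simp [twoBlock, Matrix.mul_apply, Fin.sum_univ_succ, Matrix.one_apply, Fin.ext_iff] <;>
    first
    | linear_combination h
    | ring1
    | simp [← Fin.ext_iff]

/-- `twoBlock` for a block of determinant one. -/
def twoBlockGL (n : ℕ) {a b c d : R} (h : a * d - b * c = 1) : GL (Fin (n + 2)) R where
  val := twoBlock n a b c d
  inv := twoBlock n d (-b) (-c) a
  val_inv := twoBlock_mul_adjugate n h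
  inv_val := by
    have := twoBlock_mul_adjugate n (a := d) (b := -b) (c := -c) (d := a)
      (by linear_combination h)
    simpa using this

/-- Over a Hermite ring, a unimodular vector is the first row of an invertible matrix. -/
theorem IsHermiteRing.exists_row_eq (hR : IsHermiteRing R) (n : ℕ) (u w : Fin (n + 1) → R)
    (h : u ⬝ᵥ w = 1) : ∃ P : GL (Fin (n + 1)) R, ∀ j, P.val 0 j = u j := by
  induction n with
  | zero =>
    have h0 : u 0 * w 0 = 1 := by simpa [dotProduct] using h
    refine ⟨⟨Matrix.of fun _ _ => u 0, Matrix.of fun _ _ => w 0, ?_, ?_⟩, fun j => ?_⟩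
    · ext i j
      simp [Matrix.mul_apply, Matrix.one_apply, h0, Fin.fin_one_eq_zero i, Fin.fin_one_eq_zero j]
    · ext i j
      simp [Matrix.mul_apply, Matrix.one_apply, mul_comm, h0, Fin.fin_one_eq_zero i, Fin.fin_one_eq_zero j]
    · rw [Fin.fin_one_eq_zero j]
      rfl
  | succ n ih =>
    obtain ⟨r, v, v', hv, hvv'⟩ := hR.exists_eq_smul_fin n (Fin.tail u)
    obtain ⟨P, hP⟩ := ih v v' hvv'
    have hv' : ∀ i, u i.succ = r * v i := fun i => congrFun hv i
    have hdet : u 0 * w 0 - r * -(v ⬝ᵥ Fin.tail w) = 1 := by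
      rw [← h]
      simp only [dotProduct, Fin.sum_univ_succ (n := n + 1), hv', Fin.tail, mul_assoc,
        ← Finset.mul_sum]
      ring
    -- The first row `(u 0, r, 0, …)` of the left factor meets the row `v` of `P`, giving `(u 0, r •
    -- v) = u`.
    refine ⟨twoBlockGL n hdet * oneBlockGL P, fun j => ?_⟩
    rw [Units.val_mul]
    refine Fin.cases ?_ (fun j => ?_) j
    · simp [twoBlockGL, oneBlockGL, Matrix.mul_apply, Fin.sum_univ_succ (n := n + 1), twoBlock]
    · simp [twoBlockGL, oneBlockGL, Matrix.mul_apply, Fin.sum_univ_succ, twoBlock, hP, hv']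

theorem IsHermiteRing.exists_col_eq (hR : IsHermiteRing R) (n : ℕ) (u w : Fin (n + 1) → R)
    (h : u ⬝ᵥ w = 1) : ∃ P : GL (Fin (n + 1)) R, ∀ j, P.val j 0 = u j := by
  obtain ⟨P, hP⟩ := hR.exists_row_eq n u w h
  refine ⟨⟨P.valᵀ, P⁻¹.valᵀ, ?_, ?_⟩, hP⟩
  · rw [← transpose_mul, Units.inv_mul, transpose_one]
  · rw [← transpose_mul, Units.mul_inv, transpose_one]

/-- The unipotent matrix with first column `(1, c)`. -/
def colGL {n : ℕ} (c : Fin n → R) : GL (Fin (n + 1)) R where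
  val := Matrix.of (Fin.cons (Fin.cons 1 0) fun i => Fin.cons (c i) ((1 : Matrix _ _ R) i))
  inv := Matrix.of (Fin.cons (Fin.cons 1 0) fun i => Fin.cons (-c i) ((1 : Matrix _ _ R) i))
  val_inv := by
    ext i j
    refine Fin.cases ?_ (fun i => ?_) i <;> refine Fin.cases ?_ (fun j => ?_) j <;>
      simp [Matrix.mul_apply, Fin.sum_univ_succ, Matrix.one_apply, Fin.ext_iff] <;>
      simp [← Fin.ext_iff]
  inv_val := by
    ext i j
    refine Fin.cases ?_ (fun i => ?_) i <;> refine Fin.cases ?_ (fun j => ?_) j <;>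
      simp [Matrix.mul_apply, Fin.sum_univ_succ, Matrix.one_apply, Fin.ext_iff] <;>
      simp [← Fin.ext_iff]

/-- The unipotent matrix with first row `(1, c)`. -/
def rowGL {n : ℕ} (c : Fin n → R) : GL (Fin (n + 1)) R where
  val := Matrix.of (Fin.cons (Fin.cons 1 c) fun i => Fin.cons 0 ((1 : Matrix _ _ R) i))
  inv := Matrix.of (Fin.cons (Fin.cons 1 (-c)) fun i => Fin.cons 0 ((1 : Matrix _ _ R) i))
  val_inv := by
    ext i j
    refine Fin.cases ?_ (fun i => ?_) i <;> refine Fin.cases ?_ (fun j => ?_) j <;>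
      simp [Matrix.mul_apply, Fin.sum_univ_succ, Matrix.one_apply, Fin.ext_iff] <;>
      simp [← Fin.ext_iff]
  inv_val := by
    ext i j
    refine Fin.cases ?_ (fun i => ?_) i <;> refine Fin.cases ?_ (fun j => ?_) j <;>
      simp [Matrix.mul_apply, Fin.sum_univ_succ, Matrix.one_apply, Fin.ext_iff] <;>
      simp [← Fin.ext_iff]

theorem exists_mul_mul_eq_oneBlock {m n : ℕ} (A : Matrix (Fin (m + 1)) (Fin (n + 1)) R)
    (h : A 0 0 = 1) : ∃ (P : GL (Fin (m + 1)) R) (Q : GL (Fin (n + 1)) R)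
      (A' : Matrix (Fin m) (Fin n) R), P.val * A * Q.val =
        oneBlock A' := by
  refine ⟨colGL fun i => -A i.succ 0, rowGL fun j => -A 0 j.succ,
    Matrix.of fun i j => A i.succ j.succ - A i.succ 0 * A 0 j.succ, ?_⟩
  ext i j
  refine Fin.cases ?_ (fun i => ?_) i <;> refine Fin.cases ?_ (fun j => ?_) j <;>
    simp [Matrix.mul_apply, Fin.sum_univ_succ, Matrix.one_apply, colGL, rowGL, h]
  ring

end Blocks

/-! ### Diagonal reduction and its consequences. -/

section ElementaryDivisor

variable {R : Type*} [CommRing R]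

/-- After the content `r` is removed, the corner can be made `1`, which divides whatever the
induction produces on the remaining block. -/
theorem IsHermiteRing.admitsDiagonalReduction (hR : IsHermiteRing R)
    (h2 : ∀ M : Matrix (Fin 2) (Fin 2) R, IsUnimodular R M → ∃ x y, x ⬝ᵥ M *ᵥ y = 1)
    (m n : ℕ) (A : Matrix (Fin m) (Fin n) R) : AdmitsDiagonalReduction A := by
  induction m generalizing n with
  | zero => exact ⟨1, 1, _, rfl, fun i => i.elim0, fun k hm => absurd hm (by omega)⟩
  | succ m ih =>
    cases n with
    | zero => exact ⟨1, 1, _, rfl, fun _ j => j.elim0, fun k _ hn => absurd hn (by omega)⟩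
    | succ n =>
      obtain ⟨r, A', rfl, hu⟩ := hR.exists_matrix_eq_smul A
      obtain ⟨x, y, hxy⟩ := exists_dotProduct_mulVec_eq_one_of_dvd hu
        (hR.exists_dotProduct_mulVec_dvd h2 m n A')
      obtain ⟨P₁, hP₁⟩ := hR.exists_row_eq m x _ hxy
      obtain ⟨Q₁, hQ₁⟩ := hR.exists_col_eq n y (x ᵥ* A') (by
        rw [dotProduct_comm, ← dotProduct_mulVec, hxy])
      obtain ⟨P₂, Q₂, A₁, h₂⟩ := exists_mul_mul_eq_oneBlock
        (P₁.val * A' * Q₁.val) (by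
          rw [← hxy, Matrix.mul_assoc]
          simp only [Matrix.mul_apply, dotProduct, mulVec, hP₁, hQ₁])
      obtain ⟨P₃, Q₃, D, h₃, hoff, hdvd⟩ := ih n A₁
      refine ⟨oneBlockGL P₃ * P₂ * P₁, Q₁ * Q₂ * oneBlockGL Q₃, r • oneBlock D, ?_, ?_, ?_⟩
      · rw [← h₃, ← oneBlock_mul, ← oneBlock_mul, ← h₂]
        simp only [Units.val_mul, Matrix.mul_assoc, Matrix.mul_smul, Matrix.smul_mul]
        rfl
      · intro i j hij
        rw [Matrix.smul_apply, smul_eq_mul]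
        refine mul_eq_zero_of_right _ ?_
        revert hij
        refine Fin.cases ?_ (fun i => ?_) i <;> refine Fin.cases ?_ (fun j => ?_) j
        · simp
        · simp
        · simp
        · intro hij
          exact hoff i j (by simpa using hij)
      · intro k hm hn
        simp only [Matrix.smul_apply, smul_eq_mul]
        refine mul_dvd_mul_left r ?_
        cases k with
        | zero => exact one_dvd _
        | succ k => exact hdvd k (by omega) (by omega)

theorem IsElementaryDivisorRing.exists_diagonal (hR : IsElementaryDivisorRing R)
    {A : Matrix (Fin 2) (Fin 2) R} (hA : IsUnimodular R A) :
    ∃ (P Q : GL (Fin 2) R) (d e : R), IsUnit d ∧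
      P.val * A * Q.val = !![d, 0; 0, e] := by
  obtain ⟨P, Q, D, hD, hoff, hdvd⟩ := hR 2 2 (by norm_num) (by norm_num) A
  have h01 : D 0 1 = 0 := hoff 0 1 (by simp)
  have h10 : D 1 0 = 0 := hoff 1 0 (by simp)
  have h : D 0 0 ∣ D 1 1 := hdvd 0 (by norm_num) (by norm_num)
  have hDeq : D = !![D 0 0, 0; 0, D 1 1] := by
    rw [← h01]
    conv_rhs => rw [h01, ← h10]
    ext i j
    fin_cases i <;> fin_cases j <;> simp [h01, h10]
  refine ⟨P, Q, D 0 0, D 1 1, isUnit_of_dvd_unimodular hA fun i j => ?_, hD.trans hDeq⟩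
  have hall : ∀ i j, D 0 0 ∣ D i j := by
    intro i j
    fin_cases i <;> fin_cases j <;> simp [h01, h10, h]
  have hAD : A = P⁻¹.val * D * Q⁻¹.val := by
    rw [← hD]
    simp only [Matrix.mul_assoc, Units.mul_inv, Matrix.mul_one]
    rw [← Matrix.mul_assoc, Units.inv_mul, Matrix.one_mul]
  rw [hAD]
  simp only [Matrix.mul_apply]
  exact Finset.dvd_sum fun k _ => (Finset.dvd_sum fun l _ => (hall l k).mul_left _).mul_right _

theorem IsElementaryDivisorRing.isWeaklyDeterminantLiftable (hR : IsElementaryDivisorRing R)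
    {A : Matrix (Fin 2) (Fin 2) R} (hA : IsUnimodular R A) : IsWeaklyDeterminantLiftable A := by
  obtain ⟨P, Q, d, e, hd, h⟩ := hR.exists_diagonal hA
  set P' := P⁻¹.val with hP'
  set Q' := Q⁻¹.val with hQ'
  have he : e ∈ Ideal.span {A.det} := by
    have := congrArg det h
    rw [det_mul, det_mul, det_fin_two_of] at this
    obtain ⟨d', hd'⟩ := isUnit_iff_exists_inv.1 hd
    rw [Ideal.mem_span_singleton']
    exact ⟨d' * P.val.det * Q.val.det, by
      linear_combination d' * this + e * hd'⟩
  have hAD : A = P' * !![d, 0; 0, e] * Q' := by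
    rw [← h]
    simp only [Matrix.mul_assoc, hQ', Units.mul_inv, Matrix.mul_one]
    rw [← Matrix.mul_assoc, hP', Units.inv_mul, Matrix.one_mul]
  refine ⟨P' * !![d, 0; 0, 0] * Q', fun i j => ?_, by simp [det_mul, det_fin_two_of]⟩
  have hsub : A i j - (P' * !![d, 0; 0, 0] * Q') i j = P' i 1 * Q' 1 j * e := by
    conv_lhs => rw [hAD]
    simp [Matrix.mul_apply, Fin.sum_univ_two]
    ring
  rw [hsub]
  exact Ideal.mul_mem_left _ _ he

theorem isUnimodular_triangular {a b c : R} (h : IsUnimodular R ![a, b, c]) :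
    IsUnimodular R !![a, b; 0, c] := by
  obtain ⟨w, hw⟩ := isUnimodular_pi_iff.1 h
  refine isUnimodular_matrix_iff.2 ⟨!![w 0, w 1; 0, w 2], ?_⟩
  simp [dotProduct, Fin.sum_univ_succ] at hw ⊢
  linear_combination hw

/-- The unit corner of the diagonal form says that `!![a, b; 0, c]` takes the value `1` at `(p, q)`
and `(s, t)`; expanding the product shows that this relation is the required equation. -/
theorem IsElementaryDivisorRing.exists_factorization (hR : IsElementaryDivisorRing R) {a b c : R}
    (h : IsUnimodular R ![a, b, c]) :
    ∃ x y z w : R, (1 - a * x) * (1 - c * w) = y * (b + a * c * z) := by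
  obtain ⟨P, Q, d, e, hd, h⟩ := hR.exists_diagonal (isUnimodular_triangular h)
  obtain ⟨d', hd'⟩ := isUnit_iff_exists_inv.1 hd
  have h00 := congrFun₂ h 0 0
  simp [Matrix.mul_apply, Fin.sum_univ_two] at h00
  generalize P.val 0 0 = p at h00
  generalize P.val 0 1 = q at h00
  obtain ⟨s, hs⟩ : ∃ s, s = Q.val 0 0 * d' := ⟨_, rfl⟩
  obtain ⟨t, ht⟩ : ∃ t, t = Q.val 1 0 * d' := ⟨_, rfl⟩
  have key : p * a * s + (p * b + q * c) * t = 1 := by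
    rw [hs, ht]
    linear_combination d' * h00 + hd'
  exact ⟨s * p, t * p, q * s, t * q, by linear_combination -key⟩

end ElementaryDivisor

/-! ### From the factorization to liftability, and from liftability to the value `1`. -/

section Liftability

variable {R : Type*} [CommRing R]

theorem IsHermiteRing.isWeaklyDeterminantLiftable (hR : IsHermiteRing R)
    (h3 : ∀ a b c : R, IsUnimodular R ![a, b, c] →
      ∃ x y z w : R, (1 - a * x) * (1 - c * w) = y * (b + a * c * z))
    {A : Matrix (Fin 2) (Fin 2) R} (hA : IsUnimodular R A) : IsWeaklyDeterminantLiftable A := by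
  obtain ⟨W, hW⟩ := isUnimodular_matrix_iff.1 hA
  obtain ⟨a, u, v, s, t, hu, hv, hst⟩ := hR.exists_pair (A 0 0) (A 1 0)
  simp only [Fin.sum_univ_two] at hW
  obtain ⟨b, hb⟩ : ∃ b, b = s * A 0 1 + t * A 1 1 := ⟨_, rfl⟩
  obtain ⟨c, hc⟩ : ∃ c, c = u * A 1 1 - v * A 0 1 := ⟨_, rfl⟩
  have h01 : A 0 1 = u * b - t * c := by rw [hb, hc]; linear_combination -(A 0 1) * hst
  have h11 : A 1 1 = v * b + s * c := by rw [hb, hc]; linear_combination -(A 1 1) * hst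
  have hdet : A.det = a * c := by
    rw [det_fin_two, hu, hv, hc]
    ring
  obtain ⟨x, y, z, w, h⟩ := h3 a b c (isUnimodular_pi_iff.2
    ⟨![u * W 0 0 + v * W 1 0, u * W 0 1 + v * W 1 1, s * W 1 1 - t * W 0 1], by
      simp [dotProduct, Fin.sum_univ_succ]
      rw [hu, hv, h01, h11] at hW
      linear_combination hW⟩)
  -- This is `!![u, -t; v, s]`, of determinant one, times `!![a(1-cw), b+acz; acy, c(1-ax)]`. The
  -- latter is congruent to `!![a, b; 0, c]` modulo `ac`, and `h` says that its determinant
  -- vanishes.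
  refine ⟨!![u * (a * (1 - c * w)) - t * (a * c * y), u * (b + a * c * z) - t * (c * (1 - a * x));
    v * (a * (1 - c * w)) + s * (a * c * y), v * (b + a * c * z) + s * (c * (1 - a * x))], ?_, ?_⟩
  · intro i j
    rw [hdet, Ideal.mem_span_singleton']
    fin_cases i <;> fin_cases j
    · exact ⟨u * w + t * y, by simp [hu]; ring⟩
    · exact ⟨-u * z - t * x, by simp [h01]; ring⟩
    · exact ⟨v * w - s * y, by simp [hv]; ring⟩
    · exact ⟨-v * z + s * x, by simp [h11]; ring⟩
  · rw [det_fin_two_of]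
    linear_combination a * c * (u * s + v * t) * h

/-- Over a reduced pre-Schreier Hermite ring, an upper triangular matrix of determinant zero whose
entries are coprime to `Δ` is the product of a column and a row modulo `Δ`. -/
theorem IsHermiteRing.exists_column_mul_row_triangular [IsReduced R] [DecompositionMonoid R]
    (hR : IsHermiteRing R) {p q s Δ : R} (hps : p * s = 0)
    (hu : ∃ x y z t : R, x * p + y * q + z * s + t * Δ = 1) :
    ∃ α β γ δ : R, p = α * γ ∧ q = α * δ ∧ s = β * δ ∧ Δ ∣ β * γ := by
  obtain ⟨d, p', s', m, n, hp, hs, hmn⟩ := hR.exists_pair p s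
  -- The square is `p * s * p' * s' = 0`, so reducedness applies.
  have hd : d * p' * s' = 0 := by
    refine eq_zero_of_pow_eq_zero (n := 2) ?_
    rw [hp, hs] at hps
    linear_combination p' * s' * hps
  -- Since `p * s = 0`, the product is `q * (q + p + s)`. Splitting `q = α * δ` makes `α` divide `p`
  -- and `δ` divide `s`.
  obtain ⟨α, δ, ⟨γ, hγ⟩, ⟨β, hβ⟩, hq⟩ := exists_dvd_and_dvd_of_dvd_mul
    (show q ∣ (q + p) * (q + s) from ⟨q + p + s, by linear_combination hps⟩)
  obtain ⟨x, y, z, t, h⟩ := hu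
  have hγ' : p = α * (γ - δ) := by linear_combination hγ - hq
  have hβ' : s = (β - α) * δ := by linear_combination hβ - hq
  -- As `d * p' * s' = 0`, the factor `m * p'` fixes `p` and `n * s'` fixes `s`. The lower left
  -- product then annihilates `p`, `q` and `s`, so unimodularity makes it a multiple of `Δ`.
  refine ⟨α, n * s' * (β - α), m * p' * (γ - δ), δ, ?_, hq, ?_, ?_⟩
  · linear_combination (m * p') * hγ' - p * hmn + n * s' * hp + n * hd
  · linear_combination (n * s') * hβ' - s * hmn + m * p' * hs + m * hd
  · refine ⟨t * (m * n * p' * s' * (β - α) * (γ - δ)), ?_⟩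
    have e1 : p * (p' * s') = 0 := by rw [hp]; linear_combination p' * hd
    have e2 : s * (p' * s') = 0 := by rw [hs]; linear_combination s' * hd
    have e3 : q * ((β - α) * (γ - δ)) = 0 := by
      rw [hγ', hβ'] at hps
      rw [hq]
      linear_combination hps
    linear_combination -(m * n * p' * s' * (β - α) * (γ - δ)) * h +
      x * m * n * (β - α) * (γ - δ) * e1 + z * m * n * (β - α) * (γ - δ) * e2 +
      y * m * n * p' * s' * e3

/-- A row change of determinant one makes the lift triangular; unimodularity of `A` passes to the
lift only modulo `Δ`, which is why the triangular case admits `Δ` as a fourth generator. -/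
theorem IsHermiteRing.exists_column_mul_row [IsReduced R] [DecompositionMonoid R]
    (hR : IsHermiteRing R) {A : Matrix (Fin 2) (Fin 2) R} (hA : IsUnimodular R A)
    (h : IsWeaklyDeterminantLiftable A) :
    ∃ (u v : Fin 2 → R) (C : Matrix (Fin 2) (Fin 2) R), ∀ i j, A i j = u i * v j + A.det * C i j := by
  obtain ⟨W, hW⟩ := isUnimodular_matrix_iff.1 hA
  obtain ⟨B, hAB, hB⟩ := h
  simp only [Ideal.mem_span_singleton'] at hAB
  choose E hE using hAB
  have hE' : ∀ i j, A i j = B i j + A.det * E i j := fun i j => by linear_combination -hE i j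
  generalize A.det = Δ at *
  obtain ⟨p, u, v, x, y, hu, hv, hxy⟩ := hR.exists_pair (B 0 0) (B 1 0)
  obtain ⟨q, hq⟩ : ∃ q, q = x * B 0 1 + y * B 1 1 := ⟨_, rfl⟩
  obtain ⟨s, hs⟩ : ∃ s, s = u * B 1 1 - v * B 0 1 := ⟨_, rfl⟩
  have h01 : B 0 1 = u * q - y * s := by rw [hq, hs]; linear_combination -(B 0 1) * hxy
  have h11 : B 1 1 = v * q + x * s := by rw [hq, hs]; linear_combination -(B 1 1) * hxy
  have hps : p * s = 0 := by
    rw [det_fin_two, hu, hv] at hB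
    rw [hs]
    linear_combination hB
  simp only [Fin.sum_univ_two, hE', hu, hv, h01, h11] at hW
  obtain ⟨α, β, γ, δ, hp', hq', hs', k, hk⟩ := hR.exists_column_mul_row_triangular (q := q)
    (Δ := Δ) hps ⟨u * W 0 0 + v * W 1 0, u * W 0 1 + v * W 1 1, x * W 1 1 - y * W 0 1,
      E 0 0 * W 0 0 + E 0 1 * W 0 1 + E 1 0 * W 1 0 + E 1 1 * W 1 1, by
        linear_combination hW⟩
  refine ⟨![u * α - y * β, v * α + x * β], ![γ, δ],
    !![E 0 0 + y * k, E 0 1; E 1 0 - x * k, E 1 1], fun i j => ?_⟩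
  rw [hE']
  fin_cases i <;> fin_cases j <;> simp
  · linear_combination hu + u * hp' + y * hk
  · linear_combination h01 + u * hq' - y * hs'
  · linear_combination hv + v * hp' - x * hk
  · linear_combination h11 + v * hq' + x * hs'

/-- The determinant identity puts `Δ` in the ideal generated by `g` and `Δ * x`, and `g`, `Δ`
generate `1`. -/
theorem isCoprime_of_det {g Δ x y z : R} (h : IsCoprime g Δ)
    (hdet : g * (Δ * z) - Δ * x * (Δ * y) = Δ) : IsCoprime g (Δ * x) := by
  obtain ⟨a, b, hab⟩ := h
  exact ⟨z + (1 - g * z + Δ * x * y) * a, -y, by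
    linear_combination (1 - g * z + Δ * x * y) * hab + b * hdet⟩

/-- A unimodular `2 × 2` matrix over a Hermite ring that is congruent modulo its determinant to the
product of a column and a row represents `1` as a bilinear form. -/
theorem IsHermiteRing.exists_dotProduct_mulVec_eq_one (hR : IsHermiteRing R)
    {A : Matrix (Fin 2) (Fin 2) R} (hA : IsUnimodular R A)
    (h : ∃ (u v : Fin 2 → R) (C : Matrix (Fin 2) (Fin 2) R),
      ∀ i j, A i j = u i * v j + A.det * C i j) :
    ∃ x y, x ⬝ᵥ A *ᵥ y = 1 := by
  obtain ⟨W, hW⟩ := isUnimodular_matrix_iff.1 hA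
  obtain ⟨u, v, C, h⟩ := h
  obtain ⟨g, u₀, u₁, x₀, x₁, hu₀, hu₁, hu⟩ := hR.exists_pair (u 0) (u 1)
  obtain ⟨k, v₀, v₁, y₀, y₁, hv₀, hv₁, hv⟩ := hR.exists_pair (v 0) (v 1)
  have hdet := det_fin_two A
  generalize A.det = Δ at *
  have h00 := h 0 0
  have h01 := h 0 1
  have h10 := h 1 0
  have h11 := h 1 1
  rw [hu₀, hv₀] at h00
  rw [hu₀, hv₁] at h01
  rw [hu₁, hv₀] at h10
  rw [hu₁, hv₁] at h11
  simp only [Fin.sum_univ_two] at hW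
  obtain ⟨e, he⟩ : ∃ e, e = x₀ * (A 0 0 * y₀ + A 0 1 * y₁) + x₁ * (A 1 0 * y₀ + A 1 1 * y₁) :=
    ⟨_, rfl⟩
  obtain ⟨f, hf⟩ : ∃ f, f = x₀ * (C 0 1 * v₀ - C 0 0 * v₁) + x₁ * (C 1 1 * v₀ - C 1 0 * v₁) :=
    ⟨_, rfl⟩
  have he' : e = g * k + Δ * (x₀ * (C 0 0 * y₀ + C 0 1 * y₁) + x₁ * (C 1 0 * y₀ + C 1 1 * y₁)) := by
    rw [he, h00, h01, h10, h11]
    linear_combination g * k * (v₀ * y₀ + v₁ * y₁) * hu + g * k * hv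
  have hf' : Δ * f = x₀ * (A 0 1 * v₀ - A 0 0 * v₁) + x₁ * (A 1 1 * v₀ - A 1 0 * v₁) := by
    rw [hf, h00, h01, h10, h11]
    ring
  -- Every entry of `A` is a multiple of `g * k` modulo `Δ`, and `e` is congruent to `g * k`.
  have hcop : IsCoprime e Δ := by
    refine ⟨u₀ * v₀ * W 0 0 + u₀ * v₁ * W 0 1 + u₁ * v₀ * W 1 0 + u₁ * v₁ * W 1 1,
      C 0 0 * W 0 0 + C 0 1 * W 0 1 + C 1 0 * W 1 0 + C 1 1 * W 1 1 -
      (u₀ * v₀ * W 0 0 + u₀ * v₁ * W 0 1 + u₁ * v₀ * W 1 0 + u₁ * v₁ * W 1 1) *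
      (x₀ * (C 0 0 * y₀ + C 0 1 * y₁) + x₁ * (C 1 0 * y₀ + C 1 1 * y₁)), ?_⟩
    rw [he']
    rw [h00, h01, h10, h11] at hW
    linear_combination hW
  -- In the determinant-one bases `(x₀, x₁)`, `(-u₁, u₀)` on the left and `(y₀, y₁)`, `(-v₁, v₀)` on
  -- the right, the corner is `e` and the other entries are multiples of `Δ`, since the second
  -- vectors kill the column or the row. A Bézout relation for the first row `(e, Δ * f)` yields the
  -- value `1`.
  obtain ⟨s, t, hst⟩ := isCoprime_of_det (x := f)
    (y := u₀ * (C 1 0 * y₀ + C 1 1 * y₁) - u₁ * (C 0 0 * y₀ + C 0 1 * y₁))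
    (z := u₀ * (C 1 1 * v₀ - C 1 0 * v₁) - u₁ * (C 0 1 * v₀ - C 0 0 * v₁)) hcop (by
      have hy : Δ * (u₀ * (C 1 0 * y₀ + C 1 1 * y₁) - u₁ * (C 0 0 * y₀ + C 0 1 * y₁)) =
          u₀ * (A 1 0 * y₀ + A 1 1 * y₁) - u₁ * (A 0 0 * y₀ + A 0 1 * y₁) := by
        rw [h00, h01, h10, h11]
        ring
      have hz : Δ * (u₀ * (C 1 1 * v₀ - C 1 0 * v₁) - u₁ * (C 0 1 * v₀ - C 0 0 * v₁)) =
          u₀ * (A 1 1 * v₀ - A 1 0 * v₁) - u₁ * (A 0 1 * v₀ - A 0 0 * v₁) := by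
        rw [h00, h01, h10, h11]
        ring
      rw [hy, hz, hf', he]
      linear_combination (u₀ * x₀ + u₁ * x₁) * (v₀ * y₀ + v₁ * y₁) * (-hdet) +
        Δ * (v₀ * y₀ + v₁ * y₁) * hu + Δ * hv)
  refine ⟨![x₀, x₁], ![s * y₀ - t * v₁, s * y₁ + t * v₀], ?_⟩
  simp [dotProduct, mulVec, Fin.sum_univ_two]
  rw [hf', he] at hst
  linear_combination hst

end Liftability

/-- `DecompositionMonoid R` says that every element of `R` is primal, i.e. `R` is pre-Schreier. -/
theorem corollaryC2 (R : Type*) [CommRing R] [IsReduced R] [DecompositionMonoid R]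
    (hR : IsHermiteRing R) :
    (IsElementaryDivisorRing R ↔
      ∀ A : Matrix (Fin 2) (Fin 2) R, IsUnimodular R A → IsWeaklyDeterminantLiftable A) ∧
    (IsElementaryDivisorRing R ↔
      ∀ a b c : R, IsUnimodular R ![a, b, c] →
        ∃ x y z w : R, (1 - a * x) * (1 - c * w) = y * (b + a * c * z)) := by
  have h : (∀ A : Matrix (Fin 2) (Fin 2) R, IsUnimodular R A → IsWeaklyDeterminantLiftable A) →
      IsElementaryDivisorRing R := fun h2 m n _ _ A =>
    hR.admitsDiagonalReduction (fun M hM =>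
      hR.exists_dotProduct_mulVec_eq_one hM (hR.exists_column_mul_row hM (h2 M hM))) m n A
  exact ⟨⟨fun h1 _ hA => h1.isWeaklyDeterminantLiftable hA, h⟩,
    ⟨fun h1 _ _ _ habc => h1.exists_factorization habc,
      fun h3 => h fun _ hA => hR.isWeaklyDeterminantLiftable h3 hA⟩⟩
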